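/- Let $(X,d_X)$ and $(Y,d_Y)$ be proper metric spaces (closed balls are compact). If $X$ and $Y$ are coarsely equivalent, then their coarse Freudenthal coronas $CF(X)\setminus X$ and $CF(Y)\setminus Y$ are homeomorphic. The notions are the following. A function $f:X\to Y$ is *coarse* if $f^{-1}(K)$ is bounded for every bounded $K\subset Y$, and *large scale continuous* if for every $m\ge 0$ there is $M>0$ such that $d_X(x,y)<m$ implies $d_Y(f(x),f(y))<M$. Two functions $f,g$ into the same metric space are *close* if there is $r>0$ with $d(f(x),g(x))<r$ for all $x$. The spaces $X$ and $Y$ are *coarsely equivalent* if there are coarse, large scale continuous functions $f:X\to Y$ and $g:Y\to X$ (not necessarily continuous) such that $g\circ f$ is close to $\mathrm{id}_X$ and $f\circ g$ is close to $\mathrm{id}_Y$. A *glacial scale* on $X$ is a sequence $\mathcal S=\{(K_i,n_i)\}_{i\ge 1}$ of pairs of bounded subsets $K_i$ of $X$ and natural numbers $n_i$ such that for every bounded $K\subset X$ and every $r>0$ there is $i$ with $K\subset K_i$ and $n_i>r$. A finite sequence $x_1,\dots,x_k$ ($k\ge 1$) in $X$ is an *$\mathcal S$-chain* if for each $i\le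 k-1$ there is $m\ge 1$ with $x_i,x_{i+1}\notin K_m$ and $d_X(x_i,x_{i+1})\le n_m$. A function $f:X\to\mathbb R$ is *glacially oscillating* if for every $\epsilon>0$ there is a glacial scale $\mathcal S$ such that $|f(x_1)-f(x_k)|<\epsilon$ for every $\mathcal S$-chain $x_1,\dots,x_k$. The *coarse Freudenthal compactification* $CF(X)$ is the compactification of $X$ induced by the set $G(X)$ of all continuous, glacially oscillating functions $X\to[0,1]$: the closure of the image of the evaluation embedding $X\to[0,1]^{G(X)}$, $x\mapsto (f(x))_{f\in G(X)}$, where $X$ is identified with its image. The corona $CF(X)\setminus X$ carries the subspace topology. -/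

import Mathlib

/-- A glacial scale on a metric space `X`: a sequence of pairs `(K i, n i)` of bounded subsets of
`X` and natural numbers such that every pair `(B, r)`, with `B` bounded and `r > 0`, satisfies
`B ⊆ K i` and `r < n i` for some `i`. -/
structure GlacialScale (X : Type*) [MetricSpace X] where
  K : ℕ → Set X
  n : ℕ → ℕ
  isBounded : ∀ i, Bornology.IsBounded (K i)
  cofinal : ∀ B : Set X, Bornology.IsBounded B → ∀ r : ℝ, 0 < r →
    ∃ i, B ⊆ K i ∧ r < (n i : ℝ)

/-- The finite sequence `x 0, …, x k` of points of `X` is an `S`-chain: for any two consecutive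
points there is an index `m` such that both lie outside `S.K m` and are at distance at most
`S.n m`. A sequence that consists of a single point is a chain. -/
def GlacialScale.IsChain {X : Type*} [MetricSpace X] (S : GlacialScale X) {k : ℕ}
    (x : Fin (k + 1) → X) : Prop :=
  ∀ i : Fin k, ∃ m : ℕ, x i.castSucc ∉ S.K m ∧ x i.succ ∉ S.K m ∧
    dist (x i.castSucc) (x i.succ) ≤ (S.n m : ℝ)

/-- Glacially oscillating real functions. -/
def GlaciallyOscillating {X : Type*} [MetricSpace X] (f : X → ℝ) : Prop :=
  ∀ ε : ℝ, 0 < ε → ∃ S : GlacialScale X, ∀ (k : ℕ) (x : Fin (k + 1) → X),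
    S.IsChain x → |f (x 0) - f (x (Fin.last k))| < ε

/-- The continuous and glacially oscillating functions `X → [0, 1]`. -/
def GlacialFunction (X : Type*) [MetricSpace X] : Type _ :=
  {f : C(X, unitInterval) // GlaciallyOscillating fun x => (f x : ℝ)}

/-- The evaluation map from `X` to the cube `[0, 1] ^ GlacialFunction X`. -/
def glacialEval (X : Type*) [MetricSpace X] (x : X) : GlacialFunction X → unitInterval :=
  fun f => f.1 x

/-- The coarse Freudenthal compactification `CF(X)`: the compactification of `X` induced by all
continuous and glacially oscillating functions `X → [0, 1]`, that is, the closure of the image of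
the evaluation map in the cube, with the subspace topology. -/
abbrev CoarseFreudenthal (X : Type*) [MetricSpace X] : Type _ :=
  closure (Set.range (glacialEval X))

/-- The canonical map `X → CF(X)`; it is a dense embedding, see below. -/
def CoarseFreudenthal.incl (X : Type*) [MetricSpace X] (x : X) : CoarseFreudenthal X :=
  ⟨glacialEval X x, subset_closure (Set.mem_range_self x)⟩

/-- The coarse Freudenthal corona `CF(X) \ X`, with the subspace topology. -/
abbrev CoarseFreudenthalCorona (X : Type*) [MetricSpace X] : Type _ :=
  {z : CoarseFreudenthal X // z ∉ Set.range (CoarseFreudenthal.incl X)}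

/-- `f` is coarse: preimages of bounded sets are bounded. -/
def IsCoarseMap {X Y : Type*} [MetricSpace X] [MetricSpace Y] (f : X → Y) : Prop :=
  ∀ K : Set Y, Bornology.IsBounded K → Bornology.IsBounded (f ⁻¹' K)

/-- `f` is large scale continuous (bornologous). -/
def LargeScaleContinuous {X Y : Type*} [MetricSpace X] [MetricSpace Y] (f : X → Y) : Prop :=
  ∀ m : ℝ, 0 ≤ m → ∃ M : ℝ, 0 < M ∧ ∀ x y : X, dist x y < m → dist (f x) (f y) < M

/-- `f` and `g` are close: they are at bounded distance from each other. -/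
def CloseMaps {X Y : Type*} [MetricSpace Y] (f g : X → Y) : Prop :=
  ∃ r : ℝ, 0 < r ∧ ∀ x : X, dist (f x) (g x) < r

/-- `X` and `Y` are coarsely equivalent: there are coarse and large scale continuous functions
(not necessarily continuous) `X → Y` and `Y → X` that are inverse to each other up to closeness. -/
def CoarselyEquivalent (X Y : Type*) [MetricSpace X] [MetricSpace Y] : Prop :=
  ∃ (f : X → Y) (g : Y → X),
    IsCoarseMap f ∧ LargeScaleContinuous f ∧ IsCoarseMap g ∧ LargeScaleContinuous g ∧
    CloseMaps (g ∘ f) id ∧ CloseMaps (f ∘ g) id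

theorem continuous_glacialEval (X : Type*) [MetricSpace X] : Continuous (glacialEval X) :=
  continuous_pi fun f => f.1.continuous

theorem glaciallyOscillating_of_eq_zero {X : Type*} [MetricSpace X] (f : X → ℝ) (B : Set X)
    (hB : Bornology.IsBounded B) (hf : ∀ x, x ∉ B → f x = 0) : GlaciallyOscillating f := by
  intro ε hε
  rcases isEmpty_or_nonempty X with hX | ⟨⟨p⟩⟩
  · refine ⟨⟨fun _ => ∅, fun i => i, fun _ => Bornology.isBounded_empty, ?_⟩,
      fun k x => (hX.false (x 0)).elim⟩
    intro C _ r _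
    obtain ⟨i, hi⟩ := exists_nat_gt r
    exact ⟨i, fun y _ => (hX.false y).elim, hi⟩
  · refine ⟨⟨fun i => B ∪ Metric.closedBall p i, fun i => i,
      fun i => hB.union Metric.isBounded_closedBall, ?_⟩, ?_⟩
    · intro C hC r _
      obtain ⟨R, hR⟩ := hC.subset_closedBall p
      obtain ⟨i, hi⟩ := exists_nat_gt (max r R)
      refine ⟨i, fun y hy => Or.inr ?_, (le_max_left _ _).trans_lt hi⟩
      exact (Metric.closedBall_subset_closedBall
        ((le_max_right _ _).trans hi.le)) (hR hy)
    · intro k x hx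
      rcases k with _ | k
      · simpa using hε
      · obtain ⟨m, h0, -, -⟩ := hx 0
        obtain ⟨m', -, h1, -⟩ := hx (Fin.last k)
        have e0 : f (x 0) = 0 := hf _ fun h => h0 (Or.inl h)
        have e1 : f (x (Fin.last (k + 1))) = 0 := hf _ fun h => h1 (Or.inl h)
        rw [e0, e1]
        simpa using hε

theorem exists_glacialFunction {X : Type*} [MetricSpace X] (x : X) {δ : ℝ} (hδ : 0 < δ) :
    ∃ f : GlacialFunction X, f.1 x = 1 ∧ ∀ y, δ ≤ dist y x → f.1 y = 0 := by
  let φ : C(X, unitInterval) :=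
    ⟨fun y => Set.projIcc 0 1 zero_le_one (1 - dist y x / δ), by fun_prop⟩
  have hz : ∀ y, δ ≤ dist y x → φ y = 0 := by
    intro y hy
    refine Set.projIcc_of_le_left zero_le_one ?_
    have : 1 ≤ dist y x / δ := (one_le_div hδ).2 hy
    linarith
  refine ⟨⟨φ, glaciallyOscillating_of_eq_zero _ (Metric.ball x δ) Metric.isBounded_ball ?_⟩,
    ?_, hz⟩
  · intro y hy
    have hy' : δ ≤ dist y x := by simpa using hy
    simp [hz y hy']
  · change Set.projIcc (0 : ℝ) 1 zero_le_one (1 - dist x x / δ) = 1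
    simp

theorem isEmbedding_glacialEval (X : Type*) [MetricSpace X] :
    Topology.IsEmbedding (glacialEval X) := by
  refine ⟨Topology.isInducing_iff_nhds.2 fun x => le_antisymm ?_ ?_, ?_⟩
  · exact (continuous_glacialEval X).continuousAt.tendsto.le_comap
  · intro U hU
    obtain ⟨δ, hδ, hU⟩ := Metric.mem_nhds_iff.1 hU
    obtain ⟨f, hf1, hf0⟩ := exists_glacialFunction x hδ
    refine ⟨{z | z f ≠ 0}, ?_, ?_⟩
    · refine (isOpen_ne.preimage (continuous_apply f)).mem_nhds ?_
      change f.1 x ≠ 0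
      simp [hf1]
    · intro y hy
      refine hU (Metric.mem_ball.2 (lt_of_not_ge fun h => hy (hf0 y h)))
  · intro x y hxy
    by_contra hne
    obtain ⟨f, hf1, hf0⟩ := exists_glacialFunction x (dist_pos.2 (Ne.symm hne))
    have h : f.1 x = f.1 y := congrFun hxy f
    rw [hf1, hf0 y le_rfl] at h
    exact one_ne_zero h

/-- `CF(X)` is compact. -/
theorem CoarseFreudenthal.compactSpace (X : Type*) [MetricSpace X] :
    CompactSpace (CoarseFreudenthal X) :=
  isCompact_iff_compactSpace.1 isClosed_closure.isCompact

/-- `X` embeds in `CF(X)`. -/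
theorem CoarseFreudenthal.isEmbedding_incl (X : Type*) [MetricSpace X] :
    Topology.IsEmbedding (CoarseFreudenthal.incl X) :=
  Topology.IsEmbedding.codRestrict (isEmbedding_glacialEval X) _ _

/-- `X` is dense in `CF(X)`. -/
theorem CoarseFreudenthal.denseRange_incl (X : Type*) [MetricSpace X] :
    DenseRange (CoarseFreudenthal.incl X) := by
  intro z
  rw [closure_subtype]
  have : Subtype.val '' Set.range (CoarseFreudenthal.incl X) = Set.range (glacialEval X) := by
    rw [← Set.range_comp]
    rfl
  rw [this]
  exact z.2

/-! Properness makes every corona point a limit of points leaving all bounded sets, so the corona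
sees functions only up to differences vanishing at infinity. A coarse, large scale continuous `f`
pulls glacially oscillating functions back to such functions, possibly discontinuous; averaging over
unit balls with a partition of unity repairs continuity at the cost of a difference vanishing at
infinity. Hence `f` induces a continuous corona map, determined by limits along filters going to
infinity. Closeness is invisible to those limits, so the two induced maps are mutually inverse. -/

/-- A glacially oscillating function varies little, far away, at any fixed scale. -/
theorem GlaciallyOscillating.exists_isBounded {X : Type*} [MetricSpace X] {u : X → ℝ}
    (hu : GlaciallyOscillating u) (r : ℝ) {ε : ℝ} (hε : 0 < ε) :
    ∃ B : Set X, Bornology.IsBounded B ∧ ∀ x y, x ∉ B → dist x y < r → |u x - u y| < ε := by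
  obtain ⟨S, hS⟩ := hu ε hε
  -- `cofinal` needs a positive radius, and `r` may not be positive. Thickening `S.K i` below keeps
  -- `y` out of it too, so `x, y` is a chain.
  obtain ⟨i, -, hi⟩ := S.cofinal ∅ Bornology.isBounded_empty (max r 1) (by positivity)
  refine ⟨Metric.thickening (max r 1) (S.K i), (S.isBounded i).thickening, fun x y hx hxy => ?_⟩
  have hxy' : dist x y < max r 1 := hxy.trans_le (le_max_left _ _)
  refine hS 1 ![x, y] fun j => ⟨i, ?_, ?_, ?_⟩
  · fin_cases j
    exact fun h => hx (Metric.self_subset_thickening (by positivity) _ h)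
  · fin_cases j
    exact fun h => hx (Metric.mem_thickening_iff.2 ⟨y, h, hxy'⟩)
  · fin_cases j
    exact (hxy'.trans hi).le

/-- Glacial oscillation depends only on the behaviour at infinity. -/
theorem GlaciallyOscillating.of_tendsto_sub {X : Type*} [MetricSpace X] {u v : X → ℝ}
    (hu : GlaciallyOscillating u)
    (h : Filter.Tendsto (fun x => v x - u x) (Bornology.cobounded X) (nhds 0)) :
    GlaciallyOscillating v := by
  intro ε hε
  obtain ⟨S, hS⟩ := hu (ε / 3) (by positivity)
  have hev : ∀ᶠ x in Bornology.cobounded X, |v x - u x| < ε / 3 := by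
    filter_upwards [Metric.tendsto_nhds.1 h (ε / 3) (by positivity)] with x hx
    simpa [Real.dist_eq] using hx
  obtain ⟨B, hB, hBv⟩ : ∃ B : Set X, Bornology.IsBounded B ∧ ∀ x ∉ B, |v x - u x| < ε / 3 :=
    ⟨{x | |v x - u x| < ε / 3}ᶜ, Bornology.isBounded_compl_iff.2 hev,
      fun x hx => Set.notMem_compl_iff.1 hx⟩
  refine ⟨⟨fun i => S.K i ∪ B, S.n, fun i => (S.isBounded i).union hB, fun C hC r hr => ?_⟩,
    fun k x hx => ?_⟩
  · obtain ⟨i, hi, hi'⟩ := S.cofinal C hC r hr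
    exact ⟨i, hi.trans Set.subset_union_left, hi'⟩
  · have hx' : S.IsChain x := fun i => by
      obtain ⟨m, h0, h1, hd⟩ := hx i
      exact ⟨m, fun h => h0 (Or.inl h), fun h => h1 (Or.inl h), hd⟩
    -- A one-point chain may lie in `B`, but its difference is zero; the endpoints of a longer chain
    -- avoid `B`.
    rcases k with _ | k
    · simpa using hε
    · obtain ⟨m, h0, -, -⟩ := hx 0
      obtain ⟨m', -, h1, -⟩ := hx (Fin.last k)
      have e0 := abs_lt.1 (hBv (x 0) fun h => h0 (Or.inr h))
      have e1 := abs_lt.1 (hBv (x (Fin.last (k + 1))) fun h => h1 (Or.inr h))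
      have e2 := abs_lt.1 (hS _ x hx')
      rw [abs_lt]
      constructor <;> linarith [e0.1, e0.2, e1.1, e1.2, e2.1, e2.2]

/-- Coarse, large scale continuous maps pull back glacially oscillating functions to such. -/
theorem GlaciallyOscillating.comp {X Y : Type*} [MetricSpace X] [MetricSpace Y] {u : Y → ℝ}
    (hu : GlaciallyOscillating u) {f : X → Y} (hf : IsCoarseMap f)
    (hf' : LargeScaleContinuous f) : GlaciallyOscillating (u ∘ f) := by
  rcases isEmpty_or_nonempty X with hX | ⟨⟨p⟩⟩
  · exact glaciallyOscillating_of_eq_zero _ ∅ Bornology.isBounded_empty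
      fun x => (hX.false x).elim
  intro ε hε
  obtain ⟨S, hS⟩ := hu ε hε
  -- Chain steps satisfy `≤ j`, while large scale continuity needs a strict bound: hence `j + 1`.
  choose M hM0 hM using fun j : ℕ => hf' (j + 1) (by positivity)
  choose c _ hc using fun j : ℕ => S.cofinal ∅ Bornology.isBounded_empty (M j) (hM0 j)
  -- The preimages make images of chains `S`-chains; the balls make the scale cofinal.
  refine ⟨⟨fun j => f ⁻¹' S.K (c j) ∪ Metric.closedBall p j, fun j => j,
    fun j => (hf _ (S.isBounded _)).union Metric.isBounded_closedBall, fun C hC r _ => ?_⟩,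
    fun k x hx => hS k (f ∘ x) fun i => ?_⟩
  · obtain ⟨R, hR⟩ := hC.subset_closedBall p
    obtain ⟨j, hj⟩ := exists_nat_gt (max r R)
    exact ⟨j, fun y hy => Or.inr (Metric.closedBall_subset_closedBall
      ((le_max_right _ _).trans hj.le) (hR hy)), (le_max_left _ _).trans_lt hj⟩
  · obtain ⟨j, h0, h1, hd⟩ := hx i
    refine ⟨c j, fun h => h0 (Or.inl h), fun h => h1 (Or.inl h), ?_⟩
    exact ((hM j _ _ (hd.trans_lt (lt_add_one _))).trans (hc j)).le

/-- Every glacially oscillating function with values in `[0, 1]` is asymptotic, at infinity, to a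
continuous one. -/
theorem GlaciallyOscillating.exists_glacialFunction {X : Type*} [MetricSpace X]
    {u : X → unitInterval} (hu : GlaciallyOscillating fun x => (u x : ℝ)) :
    ∃ F : GlacialFunction X,
      Filter.Tendsto (fun x => (F.1 x : ℝ) - u x) (Bornology.cobounded X) (nhds 0) := by
  -- Near `x` the constant `u x` is an admissible value, and the admissible sets are convex.
  obtain ⟨F, hF⟩ := exists_continuous_forall_mem_convex_of_local_const
    (t := fun x => convexHull ℝ ((fun y => (u y : ℝ)) '' Metric.ball x 1))
    (fun x => convex_convexHull ℝ _) fun x => ⟨u x, by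
      filter_upwards [Metric.ball_mem_nhds x one_pos] with y hy
      exact subset_convexHull ℝ _ ⟨x, Metric.mem_ball_comm.1 hy, rfl⟩⟩
  have hF01 : ∀ x, F x ∈ unitInterval := fun x =>
    convexHull_min (by rintro _ ⟨y, -, rfl⟩; exact (u y).2) (convex_Icc 0 1) (hF x)
  have ht : Filter.Tendsto (fun x => F x - u x) (Bornology.cobounded X) (nhds 0) := by
    rw [Metric.tendsto_nhds]
    intro ε hε
    obtain ⟨B, hB, h⟩ := hu.exists_isBounded 1 hε
    filter_upwards [Bornology.isBounded_def.1 hB] with x hx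
    have hx' : F x ∈ Metric.ball (u x : ℝ) ε := by
      refine convexHull_min ?_ (convex_ball _ _) (hF x)
      rintro _ ⟨y, hy, rfl⟩
      rw [Metric.mem_ball', Real.dist_eq]
      exact h x y hx (Metric.mem_ball'.1 hy)
    simpa [Real.dist_eq] using hx'
  exact ⟨⟨⟨fun x => ⟨F x, hF01 x⟩, by fun_prop⟩, hu.of_tendsto_sub ht⟩, ht⟩

theorem IsCoarseMap.tendsto_cobounded {X Y : Type*} [MetricSpace X] [MetricSpace Y] {f : X → Y}
    (hf : IsCoarseMap f) :
    Filter.Tendsto f (Bornology.cobounded X) (Bornology.cobounded Y) := by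
  intro s hs
  have h := hf sᶜ (Bornology.isBounded_compl_iff.2 hs)
  rwa [Set.preimage_compl, Bornology.isBounded_compl_iff] at h

/-- A point of the corona is a limit of points of the space that go to infinity. -/
theorem CoarseFreudenthalCorona.exists_filter {X : Type*} [MetricSpace X] [ProperSpace X]
    (z : CoarseFreudenthalCorona X) :
    ∃ l : Filter X, l.NeBot ∧ l ≤ Bornology.cobounded X ∧
      Filter.Tendsto (glacialEval X) l (nhds z.1.1) := by
  refine ⟨Filter.comap (glacialEval X) (nhds z.1.1), ?_, ?_, Filter.tendsto_comap⟩
  · refine Filter.comap_neBot fun t ht => ?_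
    obtain ⟨_, hxt, x, rfl⟩ := mem_closure_iff_nhds.1 z.1.2 t ht
    exact ⟨x, hxt⟩
  · intro s hs
    -- By properness, a bounded set lies in a compact one, whose image is closed and misses `z`.
    have hc : IsCompact (closure sᶜ) :=
      (Bornology.isBounded_compl_iff.2 hs).isCompact_closure
    have hK := hc.image (continuous_glacialEval X)
    refine ⟨(glacialEval X '' closure sᶜ)ᶜ, hK.isClosed.isOpen_compl.mem_nhds ?_, ?_⟩
    · rintro ⟨x, -, hx⟩
      exact z.2 ⟨x, Subtype.ext hx⟩
    · intro x hx
      by_contra hxs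
      exact hx ⟨x, subset_closure hxs, rfl⟩

/-- A limit in the cube of points of the space that go to infinity is not in the space. -/
theorem notMem_range_glacialEval {X : Type*} [MetricSpace X] {ι : Type*} {l : Filter ι} [l.NeBot]
    {f : ι → X} (hf : Filter.Tendsto f l (Bornology.cobounded X))
    {z : GlacialFunction X → unitInterval}
    (hz : Filter.Tendsto (fun i => glacialEval X (f i)) l (nhds z)) :
    z ∉ Set.range (glacialEval X) := by
  rintro ⟨x, rfl⟩
  obtain ⟨φ, hφ1, hφ0⟩ := exists_glacialFunction x one_pos
  have h1 : Filter.Tendsto (fun i => φ.1 (f i)) l (nhds (φ.1 x)) := tendsto_pi_nhds.1 hz φ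
  have h0 : Filter.Tendsto (fun i => φ.1 (f i)) l (nhds 0) := by
    refine tendsto_const_nhds.congr' ?_
    filter_upwards [hf (Bornology.isBounded_def.1 (Metric.isBounded_ball (x := x) (r := 1)))]
      with i hi
    exact (hφ0 _ (by simpa using hi)).symm
  have := tendsto_nhds_unique h1 h0
  rw [hφ1] at this
  exact one_ne_zero this

/-- A coarse, large scale continuous map extends to the coronas. -/
theorem exists_corona_map {X Y : Type*} [MetricSpace X] [ProperSpace X] [MetricSpace Y]
    {f : X → Y} (hf : IsCoarseMap f) (hf' : LargeScaleContinuous f) :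
    ∃ F : CoarseFreudenthalCorona X → CoarseFreudenthalCorona Y, Continuous F ∧
      ∀ (z : CoarseFreudenthalCorona X) (l : Filter X), l ≤ Bornology.cobounded X →
        Filter.Tendsto (glacialEval X) l (nhds z.1.1) →
        Filter.Tendsto (fun x => glacialEval Y (f x)) l (nhds (F z).1.1) := by
  choose P hP using fun h : GlacialFunction Y =>
    GlaciallyOscillating.exists_glacialFunction (u := fun x => h.1 (f x)) (h.2.comp hf hf')
  -- Reindexing coordinates along `P` is continuous on the whole cube, so only its effect on the
  -- corona needs checking.
  let F₀ : (GlacialFunction X → unitInterval) → GlacialFunction Y → unitInterval :=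
    fun z h => z (P h)
  have hF₀ : Continuous F₀ := continuous_pi fun h => continuous_apply (P h)
  have hlim : ∀ (z : GlacialFunction X → unitInterval) (l : Filter X),
      l ≤ Bornology.cobounded X → Filter.Tendsto (glacialEval X) l (nhds z) →
      Filter.Tendsto (fun x => glacialEval Y (f x)) l (nhds (F₀ z)) := by
    intro z l hl hz
    refine tendsto_pi_nhds.2 fun h => tendsto_subtype_rng.2 ?_
    have h1 : Filter.Tendsto (fun x => ((P h).1 x : ℝ)) l (nhds (z (P h) : ℝ)) :=
      (continuous_subtype_val.tendsto _).comp (tendsto_pi_nhds.1 hz (P h))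
    simpa [glacialEval, F₀] using h1.sub ((hP h).mono_left hl)
  have hmem : ∀ z : CoarseFreudenthalCorona X,
      F₀ z.1.1 ∈ closure (Set.range (glacialEval Y)) ∧
        F₀ z.1.1 ∉ Set.range (glacialEval Y) := by
    intro z
    obtain ⟨l, hl, hlb, hlz⟩ := z.exists_filter
    have h := hlim _ l hlb hlz
    exact ⟨mem_closure_of_tendsto h (Filter.Eventually.of_forall fun x => ⟨f x, rfl⟩),
      notMem_range_glacialEval (hf.tendsto_cobounded.mono_left hlb) h⟩
  refine ⟨fun z => ⟨⟨F₀ z.1.1, (hmem z).1⟩, ?_⟩, ?_, fun z l => hlim z.1.1 l⟩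
  · rintro ⟨y, hy⟩
    exact (hmem z).2 ⟨y, congrArg Subtype.val hy⟩
  · exact ((hF₀.comp (continuous_subtype_val.comp continuous_subtype_val)).subtype_mk _).subtype_mk _

/-- Maps close to the identity do not move limits at infinity. -/
theorem CloseMaps.tendsto_glacialEval {X : Type*} [MetricSpace X] {φ : X → X}
    (hφ : CloseMaps φ id) {l : Filter X} (hl : l ≤ Bornology.cobounded X)
    {z : GlacialFunction X → unitInterval}
    (hz : Filter.Tendsto (glacialEval X) l (nhds z)) :
    Filter.Tendsto (fun x => glacialEval X (φ x)) l (nhds z) := by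
  obtain ⟨r, -, hr⟩ := hφ
  refine tendsto_pi_nhds.2 fun h => tendsto_subtype_rng.2 ?_
  have h1 : Filter.Tendsto (fun x => (h.1 x : ℝ)) l (nhds (z h : ℝ)) :=
    (continuous_subtype_val.tendsto _).comp (tendsto_pi_nhds.1 hz h)
  have h2 : Filter.Tendsto (fun x => (h.1 x : ℝ) - h.1 (φ x)) l (nhds 0) := by
    rw [Metric.tendsto_nhds]
    intro ε hε
    obtain ⟨B, hB, hBε⟩ := h.2.exists_isBounded r hε
    filter_upwards [hl (Bornology.isBounded_def.1 hB)] with x hx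
    simpa [Real.dist_eq] using hBε x (φ x) hx (by simpa [dist_comm] using hr x)
  simpa [glacialEval] using h1.sub h2

theorem proposition4p6 {X Y : Type*} [MetricSpace X] [ProperSpace X]
    [MetricSpace Y] [ProperSpace Y] (h : CoarselyEquivalent X Y) :
    Nonempty (CoarseFreudenthalCorona X ≃ₜ CoarseFreudenthalCorona Y) := by
  obtain ⟨f, g, hf, hf', hg, hg', hgf, hfg⟩ := h
  obtain ⟨F, hF, hFl⟩ := exists_corona_map hf hf'
  obtain ⟨G, hG, hGl⟩ := exists_corona_map hg hg'
  refine ⟨⟨⟨F, G, fun z => ?_, fun z => ?_⟩, hF, hG⟩⟩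
  · obtain ⟨l, hl, hlb, hlz⟩ := z.exists_filter
    -- Along `l`, the points `g (f x)` tend to `G (F z)` and, by closeness, to `z`.
    have h := hGl (F z) (l.map f) (hf.tendsto_cobounded.mono_left hlb)
      (Filter.tendsto_map'_iff.2 (hFl z l hlb hlz))
    exact Subtype.ext (Subtype.ext (tendsto_nhds_unique (Filter.tendsto_map'_iff.1 h)
      (hgf.tendsto_glacialEval hlb hlz)))
  · obtain ⟨l, hl, hlb, hlz⟩ := z.exists_filter
    have h := hFl (G z) (l.map g) (hg.tendsto_cobounded.mono_left hlb)
      (Filter.tendsto_map'_iff.2 (hGl z l hlb hlz))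
    exact Subtype.ext (Subtype.ext (tendsto_nhds_unique (Filter.tendsto_map'_iff.1 h)
      (hfg.tendsto_glacialEval hlb hlz)))
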